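/- For $a,b>0$ let $\mathrm{Beta}(a,b)$ be the probability distribution on $[0,1]$ with density proportional to $x^{a-1}(1-x)^{b-1}$ on $(0,1)$. Call a maximizer (resp. minimizer) over the closed support of the continuous density, with values in $[0,\infty]$, a mode (resp. an anti-mode) of a distribution. 1. If $1\le a\le b$, then $\mathrm{Beta}(a,b)$ satisfies the mode-median-mean inequality: it has a mode $m_0$, a median $m_1$ and a finite mean $m_2$ with $m_0\le m_1\le m_2$. The mode is unique unless $a=b=1$. 2. If $0<a\le b\le 1$, then $\mathrm{Beta}(a,b)$ satisfies the median-mean inequality (it has a finite mean $m_2$ and a median $m_1\le m_2$) and the median-anti-mode inequality (it has a median $m_1$ and an anti-mode $m_3$ with $m_1\le m_3$). The anti-mode is unique unless $a=b=1$. -/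

import Mathlib

open MeasureTheory ProbabilityTheory
open scoped ENNReal

/-- `f` is a density of `P` with respect to Lebesgue measure that is continuous on the
(closed, topological) support of `P`. The density takes values in `[0, ∞]`, continuity being
that of `[0, ∞]`, so that it may blow up at an end point of the support; such a continuous
version is unique on the support when it exists. -/
structure IsContinuousDensity (P : Measure ℝ) (f : ℝ → ℝ≥0∞) : Prop where
  measurable : Measurable f
  eq_withDensity : P = volume.withDensity f
  continuousOn : ContinuousOn f P.support

/-- `m` is a mode of `P`: a maximizer, over the support of `P`, of the continuous density. -/
def IsMode (P : Measure ℝ) (m : ℝ) : Prop :=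
  ∃ f : ℝ → ℝ≥0∞, IsContinuousDensity P f ∧ m ∈ P.support ∧ IsMaxOn f P.support m

/-- `m` is an anti-mode of `P`: a minimizer, over the support of `P`, of the continuous
density. -/
def IsAntiMode (P : Measure ℝ) (m : ℝ) : Prop :=
  ∃ f : ℝ → ℝ≥0∞, IsContinuousDensity P f ∧ m ∈ P.support ∧ IsMinOn f P.support m

/-- `P` has a continuous density with a unique maximizer. -/
def IsUnimodal (P : Measure ℝ) : Prop := ∃! m : ℝ, IsMode P m

/-- `P` has a continuous density with a unique minimizer. -/
def IsUniantimodal (P : Measure ℝ) : Prop := ∃! m : ℝ, IsAntiMode P m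

/-- `m` is a median of the probability distribution `P`. -/
def IsMedian (P : Measure ℝ) (m : ℝ) : Prop :=
  1 / 2 ≤ P (Set.Iic m) ∧ 1 / 2 ≤ P (Set.Ici m)

/-- `P` has a finite mean, and a median lying between a mode and the mean. -/
def SatisfiesModeMedianMean (P : Measure ℝ) : Prop :=
  Integrable (fun x : ℝ => x) P ∧
    ∃ m₀ m₁ : ℝ, IsMode P m₀ ∧ IsMedian P m₁ ∧ m₀ ≤ m₁ ∧ m₁ ≤ ∫ x, x ∂P

/-- `P` has a finite mean, and a median that is at most the mean. -/
def SatisfiesMedianMean (P : Measure ℝ) : Prop :=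
  Integrable (fun x : ℝ => x) P ∧ ∃ m₁ : ℝ, IsMedian P m₁ ∧ m₁ ≤ ∫ x, x ∂P

/-- `P` has a median that is at most an anti-mode. -/
def SatisfiesMedianAntiMode (P : Measure ℝ) : Prop :=
  ∃ m₁ m₃ : ℝ, IsMedian P m₁ ∧ IsAntiMode P m₃ ∧ m₁ ≤ m₃

/-! For a density `p` with distribution function `F`, put `D t = p (c - t) - p (c + t)`. Then `2 * F
c - 1` is the integral of `D` over `t > 0`, so the sign of `D` places a median relative to `c`.

At the mode, `D ≤ 0`, hence `F ≤ 1/2` there. At the mean, `D` changes sign at most once, from plus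
to minus, at some `t₀`; since `t * D t` integrates to zero, integrating `(t₀ - t) * D t ≥ 0` gives
`F ≥ 1/2` (`le_two_mul_setIntegral_Iic_of_crossing`). The intermediate value theorem then yields a
median in between. When `a ≤ b ≤ 1`, comparison at `1/2` puts a median below `1/2`, and an anti-mode
lies above it.

The signs of `D` come from differentiating `log (p (c - t) / p (c + t))`, a rational function of `t`
(`hasDerivAt_logReflectionRatio`). -/

/-! ### The beta kernel and its maximizer -/

/-- The unnormalized beta density with exponents `α` and `β`. -/
noncomputable def betaKernel (α β x : ℝ) : ℝ := x ^ α * (1 - x) ^ β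

/-- Apply `log u ≤ u - 1` to `x / m` and `(1 - x) / (1 - m)` with weights `α` and `β`: the choice of
`m` makes the linear terms cancel. The logarithms need `m` and `x` interior, so the boundary cases
are split off. -/
lemma betaKernel_lt {α β m x : ℝ} (hα : 0 ≤ α) (hβ : 0 ≤ β) (hs : 0 < α + β)
    (hm : m * (α + β) = α) (hx : x ∈ Set.Icc (0 : ℝ) 1) (hne : x ≠ m) :
    betaKernel α β x < betaKernel α β m := by
  obtain ⟨hx0, hx1⟩ := hx
  unfold betaKernel
  rcases hα.eq_or_lt with rfl | hα
  · obtain rfl : m = 0 := by nlinarith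
    have : 0 < x := lt_of_le_of_ne hx0 (Ne.symm hne)
    simpa using Real.rpow_lt_one (by linarith) (by linarith) (by linarith : 0 < β)
  rcases hβ.eq_or_lt with rfl | hβ
  · obtain rfl : m = 1 := by nlinarith
    have : x < 1 := lt_of_le_of_ne hx1 hne
    simpa using Real.rpow_lt_one hx0 this hα
  have hm0 : 0 < m := by
    by_contra! h
    nlinarith
  have hm1 : 0 < 1 - m := by
    by_contra! h
    nlinarith
  have hpos : 0 < m ^ α * (1 - m) ^ β := by positivity
  rcases hx0.eq_or_lt with rfl | hx0
  · simpa [Real.zero_rpow hα.ne'] using hpos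
  rcases hx1.eq_or_lt with rfl | hx1
  · simpa [Real.zero_rpow hβ.ne'] using hpos
  have hx1' : 0 < 1 - x := by linarith
  have h1 : Real.log (x / m) < x / m - 1 :=
    Real.log_lt_sub_one_of_pos (by positivity) (by rwa [Ne, div_eq_one_iff_eq hm0.ne'])
  have h2 : Real.log ((1 - x) / (1 - m)) ≤ (1 - x) / (1 - m) - 1 :=
    Real.log_le_sub_one_of_pos (by positivity)
  rw [Real.log_div hx0.ne' hm0.ne'] at h1
  rw [Real.log_div hx1'.ne' hm1.ne'] at h2
  have e1 : α * (x / m - 1) = (α + β) * (x - m) := by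
    rw [← hm]; field_simp; rw [hm]
  have e2 : β * ((1 - x) / (1 - m) - 1) = (α + β) * (m - x) := by
    have : β = (α + β) * (1 - m) := by linarith
    rw [this]; field_simp; rw [← this]; ring
  have h1' := mul_lt_mul_of_pos_left h1 hα
  have h2' := mul_le_mul_of_nonneg_left h2 hβ.le
  rw [Real.rpow_def_of_pos hx0, Real.rpow_def_of_pos hx1', Real.rpow_def_of_pos hm0,
    Real.rpow_def_of_pos hm1, ← Real.exp_add, ← Real.exp_add, Real.exp_lt_exp]
  linarith

lemma continuous_betaKernel {α β : ℝ} (hα : 0 ≤ α) (hβ : 0 ≤ β) :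
    Continuous (betaKernel α β) :=
  (Real.continuous_rpow_const hα).mul
    ((Real.continuous_rpow_const hβ).comp (continuous_const.sub continuous_id))

lemma betaKernel_nonneg {α β x : ℝ} (hx : x ∈ Set.Icc (0 : ℝ) 1) : 0 ≤ betaKernel α β x :=
  mul_nonneg (Real.rpow_nonneg hx.1 _) (Real.rpow_nonneg (by linarith [hx.2]) _)

lemma betaKernel_pos {α β x : ℝ} (hx : x ∈ Set.Ioo (0 : ℝ) 1) : 0 < betaKernel α β x :=
  mul_pos (Real.rpow_pos_of_pos hx.1 _) (Real.rpow_pos_of_pos (by linarith [hx.2]) _)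

lemma betaKernel_neg {α β x : ℝ} (hx : x ∈ Set.Icc (0 : ℝ) 1) :
    betaKernel (-α) (-β) x = (betaKernel α β x)⁻¹ := by
  rw [betaKernel, betaKernel, Real.rpow_neg hx.1, Real.rpow_neg (by linarith [hx.2]), mul_inv]

/-! ### Support, continuous densities, modes and anti-modes -/

lemma betaPDFReal_eq_betaKernel {a b x : ℝ} (hx : x ∈ Set.Ioo (0 : ℝ) 1) :
    betaPDFReal a b x = 1 / beta a b * betaKernel (a - 1) (b - 1) x := by
  rw [betaPDFReal, if_pos ⟨hx.1, hx.2⟩, betaKernel, mul_assoc]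

lemma betaPDFReal_eq_zero {a b x : ℝ} (hx : x ∉ Set.Ioo (0 : ℝ) 1) : betaPDFReal a b x = 0 :=
  if_neg hx

lemma betaPDFReal_nonneg {a b : ℝ} (ha : 0 < a) (hb : 0 < b) (x : ℝ) :
    0 ≤ betaPDFReal a b x := by
  by_cases hx : x ∈ Set.Ioo (0 : ℝ) 1
  · exact (betaPDFReal_pos hx.1 hx.2 ha hb).le
  · exact (betaPDFReal_eq_zero hx).ge

lemma support_betaMeasure {a b : ℝ} (ha : 0 < a) (hb : 0 < b) :
    (betaMeasure a b).support = Set.Icc 0 1 := by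
  apply subset_antisymm
  · refine Measure.support_subset_of_isClosed isClosed_Icc ?_
    rw [mem_ae_iff, betaMeasure, withDensity_apply _ measurableSet_Icc.compl]
    refine setLIntegral_eq_zero measurableSet_Icc.compl fun x hx ↦ ?_
    rw [betaPDF, betaPDFReal_eq_zero fun h ↦ hx (Set.Ioo_subset_Icc_self h)]
    simp
  · rw [← closure_Ioo (zero_ne_one' ℝ)]
    refine closure_minimal (fun x hx ↦ ?_) Measure.isClosed_support
    rw [Measure.support_eq_forall_isOpen]
    intro u hxu hu
    have hpos : 0 < volume (u ∩ Set.Ioo (0 : ℝ) 1) :=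
      (hu.inter isOpen_Ioo).measure_pos volume ⟨x, hxu, hx⟩
    rw [pos_iff_ne_zero, betaMeasure, Ne,
      withDensity_apply_eq_zero' (by unfold betaPDF; fun_prop)]
    refine (hpos.trans_le (measure_mono ?_)).ne'
    rintro y ⟨hyu, hy⟩
    exact ⟨(ENNReal.ofReal_pos.2 (betaPDFReal_pos hy.1 hy.2 ha hb)).ne', hyu⟩

lemma measurable_betaPDF (a b : ℝ) : Measurable (betaPDF a b) := by
  unfold betaPDF; fun_prop

/-- A function that is continuous on `[0, 1]` and agrees with the beta density on `(0, 1)`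
is, on `[0, 1]`, the continuous density of the beta distribution. -/
lemma isContinuousDensity_betaMeasure {a b : ℝ} (ha : 0 < a) (hb : 0 < b) {g : ℝ → ℝ≥0∞}
    (hgm : Measurable g) (hgc : ContinuousOn g (Set.Icc 0 1))
    (hg : ∀ x ∈ Set.Ioo (0 : ℝ) 1, g x = betaPDF a b x) :
    IsContinuousDensity (betaMeasure a b) ((Set.Icc 0 1).indicator g) where
  measurable := hgm.indicator measurableSet_Icc
  eq_withDensity := by
    refine withDensity_congr_ae ?_
    filter_upwards [measure_eq_zero_iff_ae_notMem.1 (measure_singleton (μ := volume) (0 : ℝ)),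
      measure_eq_zero_iff_ae_notMem.1 (measure_singleton (μ := volume) (1 : ℝ))] with x h0 h1
    by_cases hx : x ∈ Set.Icc (0 : ℝ) 1
    · rw [Set.indicator_of_mem hx, hg x ⟨lt_of_le_of_ne hx.1 (Ne.symm h0), lt_of_le_of_ne hx.2 h1⟩]
    · rw [Set.indicator_of_notMem hx, betaPDF,
        betaPDFReal_eq_zero fun h ↦ hx (Set.Ioo_subset_Icc_self h), ENNReal.ofReal_zero]
  continuousOn := by
    rw [support_betaMeasure ha hb]
    exact hgc.congr fun x hx ↦ Set.indicator_of_mem hx g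

/-- Functions continuous on `[0, 1]` that agree almost everywhere there are equal there. Modes and
anti-modes can thus be computed from one explicit version of the density. -/
lemma IsContinuousDensity.eqOn_betaMeasure {a b : ℝ} (ha : 0 < a) (hb : 0 < b)
    {f g : ℝ → ℝ≥0∞} (hf : IsContinuousDensity (betaMeasure a b) f)
    (hgc : ContinuousOn g (Set.Icc 0 1))
    (hg : ∀ x ∈ Set.Ioo (0 : ℝ) 1, g x = betaPDF a b x) : Set.EqOn f g (Set.Icc 0 1) := by
  have hfc := hf.continuousOn
  rw [support_betaMeasure ha hb] at hfc
  have hae : betaPDF a b =ᵐ[volume] f :=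
    (withDensity_eq_iff (measurable_betaPDF a b).aemeasurable hf.measurable.aemeasurable
      (by simp [lintegral_betaPDF_eq_one ha hb])).1 hf.eq_withDensity
  refine Measure.eqOn_Icc_of_ae_eq volume zero_ne_one ?_ hfc hgc
  rw [← restrict_Ioo_eq_restrict_Icc]
  filter_upwards [ae_restrict_of_ae hae, ae_restrict_mem measurableSet_Ioo] with x hx hx'
  rw [← hx, hg x hx']

lemma isMode_betaMeasure_iff {a b m : ℝ} (ha : 1 ≤ a) (hb : 1 ≤ b) :
    IsMode (betaMeasure a b) m ↔ m ∈ Set.Icc (0 : ℝ) 1 ∧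
      ∀ x ∈ Set.Icc (0 : ℝ) 1, betaKernel (a - 1) (b - 1) x ≤ betaKernel (a - 1) (b - 1) m := by
  have ha0 : 0 < a := by linarith
  have hb0 : 0 < b := by linarith
  have hc := beta_pos ha0 hb0
  have hK : Continuous (betaKernel (a - 1) (b - 1)) :=
    continuous_betaKernel (by linarith) (by linarith)
  set g : ℝ → ℝ≥0∞ := fun x ↦ ENNReal.ofReal (1 / beta a b * betaKernel (a - 1) (b - 1) x)
  have hgc : Continuous g := ENNReal.continuous_ofReal.comp (continuous_const.mul hK)
  have hg : ∀ x ∈ Set.Ioo (0 : ℝ) 1, g x = betaPDF a b x := fun x hx ↦ by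
    rw [betaPDF, betaPDFReal_eq_betaKernel hx]
  have hle : ∀ x, ∀ y ∈ Set.Icc (0 : ℝ) 1, g x ≤ g y ↔
      betaKernel (a - 1) (b - 1) x ≤ betaKernel (a - 1) (b - 1) y := fun x y hy ↦ by
    rw [ENNReal.ofReal_le_ofReal_iff (mul_nonneg (by positivity) (betaKernel_nonneg hy)),
      mul_le_mul_iff_right₀ (by positivity)]
  unfold IsMode
  simp only [support_betaMeasure ha0 hb0]
  constructor
  · rintro ⟨f, hf, hm, hmax⟩
    have he := hf.eqOn_betaMeasure ha0 hb0 hgc.continuousOn hg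
    exact ⟨hm, fun x hx ↦ (hle x m hm).1 (he hx ▸ he hm ▸ hmax hx)⟩
  · rintro ⟨hm, h⟩
    refine ⟨_, isContinuousDensity_betaMeasure ha0 hb0 hgc.measurable hgc.continuousOn hg, hm,
      fun x hx ↦ ?_⟩
    simp only [Set.mem_ofPred_eq, Set.indicator_of_mem hx, Set.indicator_of_mem hm]
    exact (hle x m hm).2 (h x hx)

lemma isAntiMode_betaMeasure_iff {a b m : ℝ} (ha0 : 0 < a) (hb0 : 0 < b) (ha : a ≤ 1)
    (hb : b ≤ 1) :
    IsAntiMode (betaMeasure a b) m ↔ m ∈ Set.Icc (0 : ℝ) 1 ∧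
      ∀ x ∈ Set.Icc (0 : ℝ) 1, betaKernel (1 - a) (1 - b) x ≤ betaKernel (1 - a) (1 - b) m := by
  have hc := beta_pos ha0 hb0
  have hK : Continuous (betaKernel (1 - a) (1 - b)) :=
    continuous_betaKernel (by linarith) (by linarith)
  -- The inverse is taken in `[0, ∞]`, where `0⁻¹ = ∞`: this gives continuity at the end points even
  -- when the density blows up, and turns minimizers into maximizers of a kernel with nonnegative
  -- exponents.
  set g : ℝ → ℝ≥0∞ := fun x ↦
    ENNReal.ofReal (1 / beta a b) * (ENNReal.ofReal (betaKernel (1 - a) (1 - b) x))⁻¹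
  have hgc : Continuous g := (ENNReal.continuous_const_mul ENNReal.ofReal_ne_top).comp
    (ENNReal.continuous_ofReal.comp hK).inv
  have hg : ∀ x ∈ Set.Ioo (0 : ℝ) 1, g x = betaPDF a b x := fun x hx ↦ by
    rw [betaPDF, betaPDFReal_eq_betaKernel hx, ← neg_sub 1 a, ← neg_sub 1 b,
      betaKernel_neg (Set.Ioo_subset_Icc_self hx), ENNReal.ofReal_mul (by positivity),
      ENNReal.ofReal_inv_of_pos (betaKernel_pos hx)]
  have hle : ∀ x, ∀ y ∈ Set.Icc (0 : ℝ) 1, g y ≤ g x ↔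
      betaKernel (1 - a) (1 - b) x ≤ betaKernel (1 - a) (1 - b) y := fun x y hy ↦ by
    rw [ENNReal.mul_le_mul_iff_right (ENNReal.ofReal_pos.2 (by positivity)).ne'
      ENNReal.ofReal_ne_top, ENNReal.inv_le_inv, ENNReal.ofReal_le_ofReal_iff (betaKernel_nonneg hy)]
  unfold IsAntiMode
  simp only [support_betaMeasure ha0 hb0]
  constructor
  · rintro ⟨f, hf, hm, hmin⟩
    have he := hf.eqOn_betaMeasure ha0 hb0 hgc.continuousOn hg
    exact ⟨hm, fun x hx ↦ (hle x m hm).1 (he hx ▸ he hm ▸ hmin hx)⟩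
  · rintro ⟨hm, h⟩
    refine ⟨_, isContinuousDensity_betaMeasure ha0 hb0 hgc.measurable hgc.continuousOn hg, hm,
      fun x hx ↦ ?_⟩
    simp only [Set.mem_ofPred_eq, Set.indicator_of_mem hx, Set.indicator_of_mem hm]
    exact (hle x m hm).2 (h x hx)

/-! ### Densities at points reflected about `c` -/

/-- The logarithm of the ratio of `betaKernel α β (c - t)` and `betaKernel α β (c + t)`. -/
noncomputable def logReflectionRatio (α β c t : ℝ) : ℝ :=
  α * (Real.log (c - t) - Real.log (c + t)) +
    β * (Real.log (1 - c + t) - Real.log (1 - c - t))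

lemma logReflectionRatio_zero (α β c : ℝ) : logReflectionRatio α β c 0 = 0 := by
  simp [logReflectionRatio]

lemma hasDerivAt_logReflectionRatio {α β c t : ℝ} (ht : 0 ≤ t) (htc : t < c) (hc : c ≤ 1 / 2) :
    HasDerivAt (logReflectionRatio α β c)
      (2 * (β * (1 - c) * (c ^ 2 - t ^ 2) - α * c * ((1 - c) ^ 2 - t ^ 2)) /
        ((c ^ 2 - t ^ 2) * ((1 - c) ^ 2 - t ^ 2))) t := by
  have h1 : 0 < c - t := by linarith
  have h2 : 0 < c + t := by linarith
  have h3 : 0 < 1 - c + t := by linarith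
  have h4 : 0 < 1 - c - t := by linarith
  have d1 := ((hasDerivAt_id t).const_sub c).log h1.ne'
  have d2 := ((hasDerivAt_id t).const_add c).log h2.ne'
  have d3 := ((hasDerivAt_id t).const_add (1 - c)).log h3.ne'
  have d4 := ((hasDerivAt_id t).const_sub (1 - c)).log h4.ne'
  refine (((d1.sub d2).const_mul α).add ((d3.sub d4).const_mul β)).congr_deriv ?_
  rw [show c ^ 2 - t ^ 2 = (c - t) * (c + t) by ring,
    show (1 - c) ^ 2 - t ^ 2 = (1 - c + t) * (1 - c - t) by ring]
  simp only [id]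
  field_simp
  ring

lemma logReflectionRatio_le {α β c x y : ℝ} (hx : 0 ≤ x) (hxy : x ≤ y) (hyc : y < c)
    (hc : c ≤ 1 / 2)
    (h : ∀ t ∈ Set.Icc x y, α * c * ((1 - c) ^ 2 - t ^ 2) ≤ β * (1 - c) * (c ^ 2 - t ^ 2)) :
    logReflectionRatio α β c x ≤ logReflectionRatio α β c y := by
  have hd : ∀ t ∈ Set.Icc x y, HasDerivAt (logReflectionRatio α β c) _ t := fun t ht ↦
    hasDerivAt_logReflectionRatio (hx.trans ht.1) (ht.2.trans_lt hyc) hc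
  refine monotoneOn_of_deriv_nonneg (convex_Icc x y)
    (fun t ht ↦ (hd t ht).continuousAt.continuousWithinAt)
    (fun t ht ↦ (hd t (interior_subset ht)).differentiableAt.differentiableWithinAt)
    (fun t ht ↦ ?_) (Set.left_mem_Icc.2 hxy) (Set.right_mem_Icc.2 hxy) hxy
  have ht := interior_subset ht
  rw [(hd t ht).deriv]
  have h0 : 0 ≤ t := hx.trans ht.1
  have h1 : t < c := ht.2.trans_lt hyc
  have h2 : 0 < c ^ 2 - t ^ 2 := by nlinarith
  have h3 : 0 < (1 - c) ^ 2 - t ^ 2 := by nlinarith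
  have h4 := h t ht
  exact div_nonneg (by linarith) (by positivity)

lemma logReflectionRatio_neg (α β c t : ℝ) :
    logReflectionRatio (-α) (-β) c t = -logReflectionRatio α β c t := by
  unfold logReflectionRatio; ring

lemma logReflectionRatio_ge {α β c x y : ℝ} (hx : 0 ≤ x) (hxy : x ≤ y) (hyc : y < c)
    (hc : c ≤ 1 / 2)
    (h : ∀ t ∈ Set.Icc x y, β * (1 - c) * (c ^ 2 - t ^ 2) ≤ α * c * ((1 - c) ^ 2 - t ^ 2)) :
    logReflectionRatio α β c y ≤ logReflectionRatio α β c x := by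
  have := logReflectionRatio_le (α := -α) (β := -β) hx hxy hyc hc fun t ht ↦ by
    linarith [h t ht]
  rw [logReflectionRatio_neg, logReflectionRatio_neg] at this
  linarith

lemma betaKernel_eq_exp {α β x : ℝ} (hx : x ∈ Set.Ioo (0 : ℝ) 1) :
    betaKernel α β x = Real.exp (α * Real.log x + β * Real.log (1 - x)) := by
  rw [betaKernel, Real.rpow_def_of_pos hx.1, Real.rpow_def_of_pos (by linarith [hx.2]),
    ← Real.exp_add]
  ring_nf

lemma betaPDFReal_reflect_le_iff {a b c t : ℝ} (ha : 0 < a) (hb : 0 < b) (ht : 0 ≤ t)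
    (htc : t < c) (hc : c ≤ 1 / 2) :
    betaPDFReal a b (c - t) ≤ betaPDFReal a b (c + t) ↔
      logReflectionRatio (a - 1) (b - 1) c t ≤ 0 := by
  have h1 : c - t ∈ Set.Ioo (0 : ℝ) 1 := ⟨by linarith, by linarith⟩
  have h2 : c + t ∈ Set.Ioo (0 : ℝ) 1 := ⟨by linarith, by linarith⟩
  rw [betaPDFReal_eq_betaKernel h1, betaPDFReal_eq_betaKernel h2,
    mul_le_mul_iff_right₀ (one_div_pos.2 (beta_pos ha hb)), betaKernel_eq_exp h1,
    betaKernel_eq_exp h2, Real.exp_le_exp, ← sub_nonpos, logReflectionRatio,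
    show 1 - (c - t) = 1 - c + t by ring, show 1 - (c + t) = 1 - c - t by ring]
  ring_nf

lemma betaPDFReal_reflect_ge_iff {a b c t : ℝ} (ha : 0 < a) (hb : 0 < b) (ht : 0 ≤ t)
    (htc : t < c) (hc : c ≤ 1 / 2) :
    betaPDFReal a b (c + t) ≤ betaPDFReal a b (c - t) ↔
      0 ≤ logReflectionRatio (a - 1) (b - 1) c t := by
  have h1 : c - t ∈ Set.Ioo (0 : ℝ) 1 := ⟨by linarith, by linarith⟩
  have h2 : c + t ∈ Set.Ioo (0 : ℝ) 1 := ⟨by linarith, by linarith⟩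
  rw [betaPDFReal_eq_betaKernel h1, betaPDFReal_eq_betaKernel h2,
    mul_le_mul_iff_right₀ (one_div_pos.2 (beta_pos ha hb)), betaKernel_eq_exp h1,
    betaKernel_eq_exp h2, Real.exp_le_exp, ← sub_nonneg, logReflectionRatio,
    show 1 - (c - t) = 1 - c + t by ring, show 1 - (c + t) = 1 - c - t by ring]
  ring_nf

lemma betaPDFReal_sub_eq_zero {a b c t : ℝ} (h : c ≤ t) : betaPDFReal a b (c - t) = 0 :=
  betaPDFReal_eq_zero fun hx ↦ by linarith [hx.1]

/-- For `t < m`, the derivative of the log ratio has the sign of `-(a + b - 2) * t ^ 2 * (1 - 2 *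
m)`. For `t ≥ m`, the left point is outside `(0, 1)`. -/
lemma betaPDFReal_reflect_mode {a b m t : ℝ} (ha : 1 ≤ a) (hab : a ≤ b)
    (hm : m * (a + b - 2) = a - 1) (hm2 : m ≤ 1 / 2) (ht : 0 < t) :
    betaPDFReal a b (m - t) ≤ betaPDFReal a b (m + t) := by
  rcases le_or_gt m t with h | h
  · rw [betaPDFReal_sub_eq_zero h]
    exact betaPDFReal_nonneg (by linarith) (by linarith) _
  rw [betaPDFReal_reflect_le_iff (by linarith) (by linarith) ht.le h hm2,
    ← logReflectionRatio_zero (a - 1) (b - 1) m]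
  refine logReflectionRatio_ge le_rfl ht.le h hm2 fun s hs' ↦ ?_
  have hb : b - 1 = (1 - m) * (a + b - 2) := by linarith
  rw [hb, ← hm]
  have : 0 ≤ (a + b - 2) * (s ^ 2 * (1 - 2 * m)) := by
    exact mul_nonneg (by linarith) (mul_nonneg (sq_nonneg s) (by linarith))
  nlinarith

/-- For `t < 1 / 2`, the derivative of the log ratio has the sign of `b - a`. -/
lemma betaPDFReal_reflect_half {a b t : ℝ} (ha : 0 < a) (hab : a ≤ b) (ht : 0 < t) :
    betaPDFReal a b (1 / 2 + t) ≤ betaPDFReal a b (1 / 2 - t) := by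
  rcases le_or_gt (1 / 2) t with h | h
  · rw [betaPDFReal_sub_eq_zero h, betaPDFReal_eq_zero fun hx ↦ by linarith [hx.2]]
  rw [betaPDFReal_reflect_ge_iff ha (by linarith) ht.le h le_rfl,
    ← logReflectionRatio_zero (a - 1) (b - 1) (1 / 2)]
  refine logReflectionRatio_le le_rfl ht.le h le_rfl fun s hs ↦ ?_
  have : s ^ 2 ≤ (1 / 2) ^ 2 := pow_le_pow_left₀ hs.1 (hs.2.trans h.le) 2
  nlinarith

/-- The densities at the two points at distance `t` from the mean cross only once. -/
lemma exists_betaPDFReal_reflect_mean {a b : ℝ} (ha : 0 < a) (hab : a ≤ b) :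
    ∃ t₀ > 0, ∀ t > 0,
      (t < t₀ → betaPDFReal a b (a / (a + b) + t) ≤ betaPDFReal a b (a / (a + b) - t)) ∧
      (t₀ < t → betaPDFReal a b (a / (a + b) - t) ≤ betaPDFReal a b (a / (a + b) + t)) := by
  have hb : 0 < b := by linarith
  set c := a / (a + b) with hc
  have hca : a = (a + b) * c := by rw [hc]; field_simp
  have hcb : b = (a + b) * (1 - c) := by linarith
  have hc0 : 0 < c := by positivity
  have hc2 : c ≤ 1 / 2 := by rw [hc, div_le_iff₀ (by positivity)]; linarith
  -- This determines the sign of `H'`. The last factor starts positive and changes sign at most once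
  -- on `t ≥ 0`, so `H` rises from `H 0 = 0` and then possibly falls.
  have key : ∀ t, (b - 1) * (1 - c) * (c ^ 2 - t ^ 2) - (a - 1) * c * ((1 - c) ^ 2 - t ^ 2) =
      (1 - 2 * c) * (c * (1 - c) - (a + b - 1) * t ^ 2) := fun t ↦ by
    linear_combination (1 - c) * (c ^ 2 - t ^ 2) * hcb - c * ((1 - c) ^ 2 - t ^ 2) * hca
  set H := logReflectionRatio (a - 1) (b - 1) c with hH
  have hup : ∀ t, 0 ≤ t → t < c → 0 ≤ c * (1 - c) - (a + b - 1) * t ^ 2 → 0 ≤ H t := by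
    intro t ht htc hK
    rw [← logReflectionRatio_zero (a - 1) (b - 1) c]
    refine logReflectionRatio_le le_rfl ht htc hc2 fun s hs ↦ sub_nonneg.1 ?_
    rw [key]
    refine mul_nonneg (by linarith) ?_
    have h1 : s ^ 2 ≤ t ^ 2 := pow_le_pow_left₀ hs.1 hs.2 2
    have h2 : 0 < c * (1 - c) := by nlinarith
    rcases le_total 0 (a + b - 1) with h | h <;> nlinarith [sq_nonneg s]
  -- The set where `H ≥ 0` is an initial segment of `[0, c)`; its supremum will be `t₀`.
  have hdown : ∀ t u, 0 ≤ t → t < u → u < c → 0 ≤ H u → 0 ≤ H t := by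
    intro t u ht htu huc hu
    rcases le_or_gt 0 (c * (1 - c) - (a + b - 1) * t ^ 2) with hK | hK
    · exact hup t ht (htu.trans huc) hK
    refine hu.trans (logReflectionRatio_ge ht htu.le huc hc2 fun s hs ↦ sub_nonpos.1 ?_)
    rw [key]
    refine mul_nonpos_of_nonneg_of_nonpos (by linarith) ?_
    have h1 : t ^ 2 ≤ s ^ 2 := pow_le_pow_left₀ ht hs.1 2
    have h2 : 0 < c * (1 - c) := by nlinarith
    have h3 : 0 < a + b - 1 := by
      by_contra! h
      nlinarith [sq_nonneg t]
    nlinarith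
  obtain ⟨t₁, ht₁, ht₁c, hK₁⟩ :
      ∃ t₁, 0 < t₁ ∧ t₁ < c ∧ 0 ≤ c * (1 - c) - (a + b - 1) * t₁ ^ 2 := by
    have h1 : ∀ᶠ t in nhdsWithin (0 : ℝ) (Set.Ioi 0),
        0 < c * (1 - c) - (a + b - 1) * t ^ 2 := by
      have : ContinuousAt (fun t : ℝ ↦ c * (1 - c) - (a + b - 1) * t ^ 2) 0 := by fun_prop
      exact (this.eventually_const_lt (by norm_num; nlinarith)).filter_mono nhdsWithin_le_nhds
    obtain ⟨t, h, h'⟩ := (h1.and (Ioo_mem_nhdsGT hc0)).exists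
    exact ⟨t, h'.1, h'.2, h.le⟩
  set S := {t | 0 ≤ t ∧ t < c ∧ 0 ≤ H t} with hS
  have hSb : BddAbove S := ⟨c, fun t ht ↦ ht.2.1.le⟩
  have hSt : t₁ ∈ S := ⟨ht₁.le, ht₁c, hup t₁ ht₁.le ht₁c hK₁⟩
  refine ⟨sSup S, ht₁.trans_le (le_csSup hSb hSt), fun t ht ↦ ⟨fun h ↦ ?_, fun h ↦ ?_⟩⟩
  · obtain ⟨u, hu, htu⟩ := exists_lt_of_lt_csSup ⟨t₁, hSt⟩ h
    exact (betaPDFReal_reflect_ge_iff ha hb ht.le (htu.trans hu.2.1) hc2).2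
      (hdown t u ht.le htu hu.2.1 hu.2.2)
  · rcases le_or_gt c t with htc | htc
    · rw [betaPDFReal_sub_eq_zero htc]
      exact betaPDFReal_nonneg ha hb _
    · refine (betaPDFReal_reflect_le_iff ha hb ht.le htc hc2).2 ?_
      by_contra! hpos
      exact h.not_ge (le_csSup hSb ⟨ht.le, htc, hpos.le⟩)

/-! ### From reflected densities to the mass left of `c` -/

lemma setIntegral_Ioi_reflect_sub {p : ℝ → ℝ} (hp : Integrable p) (c : ℝ) :
    ∫ t in Set.Ioi 0, (p (c - t) - p (c + t)) =
      2 * (∫ x in Set.Iic c, p x) - ∫ x, p x := by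
  have hpos : ∫ t in Set.Ioi 0, p (c + t) = ∫ x in Set.Ioi c, p x := by
    rw [← (measurePreserving_add_left volume c).setIntegral_preimage_emb
      (measurableEmbedding_addLeft c) p (Set.Ioi c)]
    simp
  have hneg : ∫ t in Set.Ioi 0, p (c - t) = ∫ x in Set.Iic c, p x := by
    rw [← (measurePreserving_add_left volume c).setIntegral_preimage_emb
      (measurableEmbedding_addLeft c) p (Set.Iic c)]
    have := integral_comp_neg_Ioi 0 fun t ↦ p (c + t)
    simpa [← sub_eq_add_neg] using this
  rw [integral_sub (hp.comp_sub_left c).integrableOn (hp.comp_add_left c).integrableOn, hpos,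
    hneg, ← intervalIntegral.integral_Iic_add_Ioi hp.integrableOn hp.integrableOn (b := c)]
  ring

lemma two_mul_setIntegral_Iic_le {p : ℝ → ℝ} (hp : Integrable p) {c : ℝ}
    (h : ∀ t > 0, p (c - t) ≤ p (c + t)) : 2 * (∫ x in Set.Iic c, p x) ≤ ∫ x, p x := by
  rw [← sub_nonpos, ← setIntegral_Ioi_reflect_sub hp]
  exact setIntegral_nonpos measurableSet_Ioi fun t ht ↦ sub_nonpos.2 (h t ht)

lemma le_two_mul_setIntegral_Iic {p : ℝ → ℝ} (hp : Integrable p) {c : ℝ}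
    (h : ∀ t > 0, p (c + t) ≤ p (c - t)) : ∫ x, p x ≤ 2 * (∫ x in Set.Iic c, p x) := by
  rw [← sub_nonneg, ← setIntegral_Ioi_reflect_sub hp]
  exact setIntegral_nonneg measurableSet_Ioi fun t ht ↦ sub_nonneg.2 (h t ht)

/-- If the reflections of the density `p` about its mean cross once, the left part dominating
near the mean, then at least half of the mass lies to the left of the mean. -/
lemma le_two_mul_setIntegral_Iic_of_crossing {p : ℝ → ℝ} (hp : Integrable p)
    (hxp : Integrable fun x ↦ x * p x) {c t₀ : ℝ} (hmean : ∫ x, x * p x = c * ∫ x, p x)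
    (ht₀ : 0 < t₀)
    (h : ∀ t > 0, (t < t₀ → p (c + t) ≤ p (c - t)) ∧ (t₀ < t → p (c - t) ≤ p (c + t))) :
    ∫ x, p x ≤ 2 * (∫ x in Set.Iic c, p x) := by
  set q : ℝ → ℝ := fun t ↦ t * p (c + t) with hq
  have hqe : q = fun t ↦ (c + t) * p (c + t) - c * p (c + t) := by
    ext t; rw [hq]; ring
  have hqi : Integrable q := by
    rw [hqe]
    exact (hxp.comp_add_left c).sub ((hp.comp_add_left c).const_mul c)
  have hq0 : ∫ t, q t = 0 := by
    rw [hqe, integral_sub (hxp.comp_add_left c) ((hp.comp_add_left c).const_mul c),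
      integral_add_left_eq_self (fun x ↦ x * p x), integral_const_mul,
      integral_add_left_eq_self p, hmean, sub_self]
  have hg : IntegrableOn (fun t ↦ p (c - t) - p (c + t)) (Set.Ioi 0) :=
    ((hp.comp_sub_left c).sub (hp.comp_add_left c)).integrableOn
  -- The integrand is `t * (p (c - t) - p (c + t))`: the first moment about the mean, folded onto
  -- the half-line.
  have hfirst : ∫ t in Set.Ioi 0, (-q (-t) - q t) = 0 := by
    rw [integral_sub (f := fun t ↦ -q (-t)) hqi.comp_neg.neg.integrableOn hqi.integrableOn,
      integral_neg,
      integral_comp_neg_Ioi, neg_zero]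
    have := intervalIntegral.integral_Iic_add_Ioi hqi.integrableOn hqi.integrableOn (b := 0)
    linarith
  have hfi : IntegrableOn (fun t ↦ -q (-t) - q t) (Set.Ioi 0) :=
    (hqi.comp_neg.neg.sub hqi).integrableOn
  have hnn : 0 ≤ ∫ t in Set.Ioi 0, (t₀ * (p (c - t) - p (c + t)) - (-q (-t) - q t)) := by
    refine setIntegral_nonneg measurableSet_Ioi fun t ht ↦ ?_
    have e : t₀ * (p (c - t) - p (c + t)) - (-q (-t) - q t) =
        (t₀ - t) * (p (c - t) - p (c + t)) := by
      simp only [hq, ← sub_eq_add_neg]; ring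
    rw [e]
    rcases lt_trichotomy t t₀ with hlt | rfl | hlt
    · exact mul_nonneg (by linarith) (sub_nonneg.2 ((h t ht).1 hlt))
    · simp
    · exact mul_nonneg_of_nonpos_of_nonpos (by linarith) (sub_nonpos.2 ((h t ht).2 hlt))
  rw [integral_sub (hg.const_mul t₀) hfi, hfirst, sub_zero, integral_const_mul] at hnn
  rw [← sub_nonneg, ← setIntegral_Ioi_reflect_sub hp]
  exact nonneg_of_mul_nonneg_right hnn ht₀

/-! ### Moments and medians of the beta distribution -/

section

variable {a b : ℝ}

lemma integrable_betaPDFReal (ha : 0 < a) (hb : 0 < b) : Integrable (betaPDFReal a b) := by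
  refine ⟨(stronglyMeasurable_betaPDFReal a b).aestronglyMeasurable, ?_⟩
  rw [hasFiniteIntegral_iff_ofReal (.of_forall (betaPDFReal_nonneg ha hb))]
  exact (lintegral_betaPDF_eq_one ha hb).trans_lt ENNReal.one_lt_top

lemma integral_betaPDFReal (ha : 0 < a) (hb : 0 < b) : ∫ x, betaPDFReal a b x = 1 := by
  rw [integral_eq_lintegral_of_nonneg_ae (.of_forall (betaPDFReal_nonneg ha hb))
    (stronglyMeasurable_betaPDFReal a b).aestronglyMeasurable]
  exact (congrArg ENNReal.toReal (lintegral_betaPDF_eq_one ha hb)).trans ENNReal.toReal_one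

/-- Size-biasing stays in the beta family, so the mean follows from the normalization of
`betaPDFReal (a + 1) b`. -/
lemma mul_betaPDFReal (ha : 0 < a) (hb : 0 < b) (x : ℝ) :
    x * betaPDFReal a b x = a / (a + b) * betaPDFReal (a + 1) b x := by
  by_cases hx : x ∈ Set.Ioo (0 : ℝ) 1
  · have hbeta : beta (a + 1) b = a / (a + b) * beta a b := by
      have h1 := Real.Gamma_pos_of_pos (add_pos ha hb)
      rw [beta, beta, show a + 1 + b = a + b + 1 by ring, Real.Gamma_add_one ha.ne',
        Real.Gamma_add_one (add_pos ha hb).ne']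
      field_simp
    have hc := beta_pos ha hb
    have hpow : x ^ (a + 1 - 1) = x * x ^ (a - 1) := by
      rw [← Real.rpow_one_add' hx.1.le (by simpa using ha.ne')]
      ring_nf
    rw [betaPDFReal_eq_betaKernel hx, betaPDFReal_eq_betaKernel hx, hbeta, betaKernel, betaKernel,
      hpow]
    field_simp
  · rw [betaPDFReal_eq_zero hx, betaPDFReal_eq_zero hx, mul_zero, mul_zero]

lemma integrable_mul_betaPDFReal (ha : 0 < a) (hb : 0 < b) :
    Integrable fun x ↦ x * betaPDFReal a b x := by
  simp_rw [mul_betaPDFReal ha hb]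
  exact (integrable_betaPDFReal (by linarith) hb).const_mul _

lemma integral_mul_betaPDFReal (ha : 0 < a) (hb : 0 < b) :
    ∫ x, x * betaPDFReal a b x = a / (a + b) := by
  simp_rw [mul_betaPDFReal ha hb]
  rw [integral_const_mul, integral_betaPDFReal (by linarith) hb, mul_one]

lemma integrable_id_betaMeasure (ha : 0 < a) (hb : 0 < b) :
    Integrable (fun x : ℝ ↦ x) (betaMeasure a b) := by
  rw [betaMeasure, integrable_withDensity_iff_integrable_smul' (measurable_betaPDF a b)
    (.of_forall fun x ↦ ENNReal.ofReal_lt_top)]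
  refine (integrable_mul_betaPDFReal ha hb).congr (.of_forall fun x ↦ ?_)
  simp [betaPDF, ENNReal.toReal_ofReal (betaPDFReal_nonneg ha hb x), mul_comm]

lemma integral_id_betaMeasure (ha : 0 < a) (hb : 0 < b) :
    ∫ x, x ∂(betaMeasure a b) = a / (a + b) := by
  rw [betaMeasure, integral_withDensity_eq_integral_toReal_smul (measurable_betaPDF a b)
    (.of_forall fun x ↦ ENNReal.ofReal_lt_top), ← integral_mul_betaPDFReal ha hb]
  refine integral_congr_ae (.of_forall fun x ↦ ?_)
  simp [betaPDF, ENNReal.toReal_ofReal (betaPDFReal_nonneg ha hb x), mul_comm]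

lemma betaMeasure_apply (ha : 0 < a) (hb : 0 < b) {s : Set ℝ} (hs : MeasurableSet s) :
    betaMeasure a b s = ENNReal.ofReal (∫ x in s, betaPDFReal a b x) := by
  rw [betaMeasure, withDensity_apply _ hs,
    ofReal_integral_eq_lintegral_ofReal (integrable_betaPDFReal ha hb).integrableOn
      (.of_forall (betaPDFReal_nonneg ha hb))]
  rfl

lemma isMedian_betaMeasure (ha : 0 < a) (hb : 0 < b) {m : ℝ}
    (h : ∫ x in Set.Iic m, betaPDFReal a b x = 1 / 2) : IsMedian (betaMeasure a b) m := by
  have hi := integrable_betaPDFReal ha hb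
  have h' := intervalIntegral.integral_Iic_add_Ioi hi.integrableOn hi.integrableOn (b := m)
  rw [integral_betaPDFReal ha hb, h, ← integral_Ici_eq_integral_Ioi] at h'
  have hhalf : ENNReal.ofReal (1 / 2) = 1 / 2 := by
    rw [ENNReal.ofReal_div_of_pos two_pos]; simp
  constructor
  · rw [betaMeasure_apply ha hb measurableSet_Iic, h, hhalf]
  · rw [betaMeasure_apply ha hb measurableSet_Ici, eq_sub_of_add_eq' h', ← hhalf]
    norm_num

lemma exists_isMedian_betaMeasure (ha : 0 < a) (hb : 0 < b) {u v : ℝ} (huv : u ≤ v)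
    (hu : 2 * (∫ x in Set.Iic u, betaPDFReal a b x) ≤ 1)
    (hv : 1 ≤ 2 * (∫ x in Set.Iic v, betaPDFReal a b x)) :
    ∃ m ∈ Set.Icc u v, IsMedian (betaMeasure a b) m := by
  have hi := integrable_betaPDFReal ha hb
  have hc : Continuous fun y ↦ ∫ x in Set.Iic y, betaPDFReal a b x := by
    have := (continuous_const (y := ∫ x in Set.Iic 0, betaPDFReal a b x)).add
      (intervalIntegral.continuous_primitive (fun _ _ ↦ hi.intervalIntegrable) 0)
    refine this.congr fun y ↦ ?_
    rw [Pi.add_apply, ← intervalIntegral.integral_Iic_sub_Iic hi.integrableOn hi.integrableOn]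
    ring
  obtain ⟨m, hm, hm'⟩ := intermediate_value_Icc huv hc.continuousOn
    (show (1 / 2 : ℝ) ∈ _ from ⟨by linarith, by linarith⟩)
  exact ⟨m, hm, isMedian_betaMeasure ha hb hm'⟩

lemma setIntegral_Iic_betaPDFReal_zero : ∫ x in Set.Iic 0, betaPDFReal a b x = 0 :=
  setIntegral_eq_zero_of_forall_eq_zero fun _ hx ↦
    betaPDFReal_eq_zero fun h ↦ not_lt_of_ge hx h.1

lemma one_le_two_mul_setIntegral_Iic_mean (ha : 0 < a) (hab : a ≤ b) :
    1 ≤ 2 * (∫ x in Set.Iic (a / (a + b)), betaPDFReal a b x) := by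
  have hb : 0 < b := by linarith
  obtain ⟨t₀, ht₀, h⟩ := exists_betaPDFReal_reflect_mean ha hab
  rw [← integral_betaPDFReal ha hb]
  refine le_two_mul_setIntegral_Iic_of_crossing (integrable_betaPDFReal ha hb)
    (integrable_mul_betaPDFReal ha hb) ?_ ht₀ h
  rw [integral_mul_betaPDFReal ha hb, integral_betaPDFReal ha hb, mul_one]

lemma betaKernel_le {α β m x : ℝ} (hα : 0 ≤ α) (hβ : 0 ≤ β)
    (hm : m * (α + β) = α) (hx : x ∈ Set.Icc (0 : ℝ) 1) :
    betaKernel α β x ≤ betaKernel α β m := by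
  rcases (add_nonneg hα hβ).eq_or_lt with hs | hs
  · obtain rfl : α = 0 := by linarith
    obtain rfl : β = 0 := by linarith
    simp [betaKernel]
  · rcases eq_or_ne x m with rfl | hne
    · rfl
    · exact (betaKernel_lt hα hβ hs hm hx hne).le

lemma existsUnique_betaKernel_max {α β : ℝ} (hα : 0 ≤ α) (hβ : 0 ≤ β) (hs : 0 < α + β) :
    ∃! m, m ∈ Set.Icc (0 : ℝ) 1 ∧ ∀ x ∈ Set.Icc (0 : ℝ) 1, betaKernel α β x ≤ betaKernel α β m := by
  have hm : α / (α + β) * (α + β) = α := div_mul_cancel₀ _ hs.ne'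
  have hmem : α / (α + β) ∈ Set.Icc (0 : ℝ) 1 :=
    ⟨by positivity, div_le_one_of_le₀ (by linarith) hs.le⟩
  refine ⟨α / (α + β), ⟨hmem, fun x hx ↦ betaKernel_le hα hβ hm hx⟩, fun y ⟨hy, hmax⟩ ↦ ?_⟩
  by_contra hne
  exact (hmax _ hmem).not_gt (betaKernel_lt hα hβ hs hm hy hne)

lemma satisfiesModeMedianMean_betaMeasure (ha : 1 ≤ a) (hab : a ≤ b) :
    SatisfiesModeMedianMean (betaMeasure a b) := by
  have ha0 : 0 < a := by linarith
  have hb0 : 0 < b := by linarith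
  obtain ⟨m, hm, hm0, hm2, hmmean⟩ : ∃ m, m * (a + b - 2) = a - 1 ∧ 0 ≤ m ∧ m ≤ 1 / 2 ∧
      m ≤ a / (a + b) := by
    rcases (by linarith : 0 ≤ a + b - 2).eq_or_lt with hs | hs
    -- Here `a = b = 1`: every point of `[0, 1]` is a mode, and `0` is one below the mean.
    · exact ⟨0, by linarith, le_rfl, by norm_num, by positivity⟩
    · refine ⟨(a - 1) / (a + b - 2), div_mul_cancel₀ _ hs.ne', div_nonneg (by linarith) hs.le, ?_,
        ?_⟩
      · rw [div_le_iff₀ hs]; linarith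
      -- Cross-multiplied, the inequality reduces to `a ≤ b`.
      · rw [div_le_div_iff₀ hs (by positivity)]; nlinarith
  obtain ⟨m₁, hm₁, hmed⟩ := exists_isMedian_betaMeasure ha0 hb0 hmmean
    ((two_mul_setIntegral_Iic_le (integrable_betaPDFReal ha0 hb0)
      fun t ht ↦ betaPDFReal_reflect_mode ha hab hm hm2 ht).trans_eq
        (integral_betaPDFReal ha0 hb0))
    (one_le_two_mul_setIntegral_Iic_mean ha0 hab)
  refine ⟨integrable_id_betaMeasure ha0 hb0, m, m₁, ?_, hmed, hm₁.1, ?_⟩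
  · rw [isMode_betaMeasure_iff ha (ha.trans hab)]
    exact ⟨⟨hm0, by linarith⟩, fun x hx ↦
      betaKernel_le (by linarith) (by linarith) (by linarith) hx⟩
  · rw [integral_id_betaMeasure ha0 hb0]
    exact hm₁.2

lemma satisfiesMedianMean_betaMeasure (ha : 0 < a) (hab : a ≤ b) :
    SatisfiesMedianMean (betaMeasure a b) := by
  have hb : 0 < b := by linarith
  obtain ⟨m, hm, hmed⟩ := exists_isMedian_betaMeasure ha hb (u := 0) (by positivity)
    (by rw [setIntegral_Iic_betaPDFReal_zero]; norm_num)
    (one_le_two_mul_setIntegral_Iic_mean ha hab)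
  exact ⟨integrable_id_betaMeasure ha hb, m, hmed, by
    rw [integral_id_betaMeasure ha hb]; exact hm.2⟩

lemma satisfiesMedianAntiMode_betaMeasure (ha : 0 < a) (hab : a ≤ b) (hb1 : b ≤ 1) :
    SatisfiesMedianAntiMode (betaMeasure a b) := by
  have hb : 0 < b := by linarith
  obtain ⟨m, hm, hmed⟩ := exists_isMedian_betaMeasure ha hb (u := 0) (v := 1 / 2) (by norm_num)
    (by rw [setIntegral_Iic_betaPDFReal_zero]; norm_num)
    ((integral_betaPDFReal ha hb).symm.trans_le
      (le_two_mul_setIntegral_Iic (integrable_betaPDFReal ha hb)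
        fun t ht ↦ betaPDFReal_reflect_half ha hab ht))
  obtain ⟨c, hc, hc2, hc1⟩ : ∃ c, c * (1 - a + (1 - b)) = 1 - a ∧ 1 / 2 ≤ c ∧ c ≤ 1 := by
    rcases (by linarith : 0 ≤ 1 - a + (1 - b)).eq_or_lt with hs | hs
    -- In the uniform case every point of `[0, 1]` is an anti-mode.
    · exact ⟨1 / 2, by linarith, le_rfl, by norm_num⟩
    · refine ⟨(1 - a) / (1 - a + (1 - b)), div_mul_cancel₀ _ hs.ne', ?_, ?_⟩
      · rw [le_div_iff₀ hs]; linarith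
      · rw [div_le_one hs]; linarith
  refine ⟨m, c, hmed, ?_, hm.2.trans hc2⟩
  rw [isAntiMode_betaMeasure_iff ha hb (hab.trans hb1) hb1]
  exact ⟨⟨by linarith, hc1⟩, fun x hx ↦ betaKernel_le (by linarith) (by linarith) hc hx⟩

end

theorem corollary14 (a b : ℝ) :
    (1 ≤ a → a ≤ b →
      SatisfiesModeMedianMean (betaMeasure a b) ∧
      (¬ (a = 1 ∧ b = 1) → IsUnimodal (betaMeasure a b))) ∧
    (0 < a → a ≤ b → b ≤ 1 →
      SatisfiesMedianMean (betaMeasure a b) ∧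
      SatisfiesMedianAntiMode (betaMeasure a b) ∧
      (¬ (a = 1 ∧ b = 1) → IsUniantimodal (betaMeasure a b))) := by
  refine ⟨fun ha hab ↦ ⟨satisfiesModeMedianMean_betaMeasure ha hab, fun hne ↦ ?_⟩,
    fun ha hab hb1 ↦ ⟨satisfiesMedianMean_betaMeasure ha hab,
      satisfiesMedianAntiMode_betaMeasure ha hab hb1, fun hne ↦ ?_⟩⟩
  · simp only [IsUnimodal, isMode_betaMeasure_iff ha (ha.trans hab)]
    refine existsUnique_betaKernel_max (by linarith) (by linarith) ?_
    by_contra! h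
    exact hne ⟨by linarith, by linarith⟩
  · simp only [IsUniantimodal, isAntiMode_betaMeasure_iff ha (ha.trans_le hab) (hab.trans hb1) hb1]
    refine existsUnique_betaKernel_max (by linarith) (by linarith) ?_
    by_contra! h
    exact hne ⟨by linarith, by linarith⟩
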